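/- Let $G$ be a finite nonabelian group. Let $\mathrm{Irr}(G)$ be the set of irreducible complex characters of $G$, let $cd(G)=\{\chi(1):\chi\in \mathrm{Irr}(G)\}$ be the set of their degrees, and let $\rho(G)$ be the set of all primes dividing some element of $cd(G)$. Let $B(G)$ be the bipartite divisor graph of $cd(G)$: the undirected bipartite graph whose vertex set is the disjoint union of the two parts $\rho(G)$ and $cd(G)\setminus\{1\}$, in which $q\in\rho(G)$ is adjacent to $m\in cd(G)\setminus\{1\}$ if and only if $q$ divides $m$, and which has no other edges. Let $p$ be a prime with $p\ge 7$ and $p\ne 11$, and let $P$ be a Sylow $p$-subgroup of $G$ with $|P|=p^2$ and $[G:P]=12$. Then $B(G)$ is a cycle (that is, isomorphic to the cycle $C_n$ of length $n$ for some $n\ge 3$) if and only if $cd(G)=\{1,6,12\}$. -/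

import Mathlib

/-- `Irr(G)`: the set of irreducible complex characters of `G`, i.e. the characters of the
irreducible finite-dimensional complex representations of `G`. (Every such representation is
isomorphic to one on some `ℂⁿ`, and isomorphic representations have the same character.) -/
def irrCharacters (G : Type*) [Group G] : Set (G → ℂ) :=
  {χ | ∃ (n : ℕ) (ρ : Representation ℂ G (Fin n → ℂ)), ρ.IsIrreducible ∧ χ = ρ.character}

/-- `cd(G) = {χ(1) : χ ∈ Irr(G)}`, as a set of natural numbers. -/
def characterDegrees (G : Type*) [Group G] : Set ℕ :=
  {d | ∃ χ ∈ irrCharacters G, χ 1 = (d : ℂ)}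

/-- `ρ(G)`: the set of all primes which divide some irreducible character degree of `G`. -/
def degreePrimes (G : Type*) [Group G] : Set ℕ :=
  {q | q.Prime ∧ ∃ d ∈ characterDegrees G, q ∣ d}

/-- The bipartite divisor graph `B(G)` of the set of irreducible character degrees. Its vertex set
is the disjoint union of the two parts `ρ(G)` and `cd(G) \ {1}` (so a prime that is also a degree
gives two vertices), and `q ∈ ρ(G)` is adjacent to `m ∈ cd(G) \ {1}` iff `q ∣ m`. -/
def bipartiteDivisorGraph (G : Type*) [Group G] :
    SimpleGraph (↥(degreePrimes G) ⊕ ↥(characterDegrees G \ {1})) where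
  Adj
    | .inl q, .inr m => (q : ℕ) ∣ (m : ℕ)
    | .inr m, .inl q => (q : ℕ) ∣ (m : ℕ)
    | _, _ => False
  symm := ⟨by rintro (q | m) (q' | m') h <;> exact h⟩
  loopless := ⟨by rintro (q | m) h <;> exact h⟩

/-- A graph is a cycle if it is isomorphic to the cycle `Cₙ` of length `n` for some `n ≥ 3`. -/
def IsCycleGraph {V : Type*} (Γ : SimpleGraph V) : Prop :=
  ∃ n : ℕ, 3 ≤ n ∧ Nonempty (Γ ≃g SimpleGraph.cycleGraph n)

/-! A group of order `p ^ 2` is abelian, so every irreducible degree is at most `[G:P] = 12`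
(`le_index_of_mem_characterDegrees`). In a cycle each vertex has two neighbours: a degree other than
1 has two prime divisors, leaving 6, 10, 12, and each prime divides two degrees, which rules out 10
and forces both 6 and 12. Conversely, these degrees give the 4-cycle 2, 6, 3, 12. -/

/-- A commuting family of endomorphisms of a nonzero finite-dimensional space over an algebraically
closed field has a common eigenvector. -/
theorem exists_common_eigenvector_of_commute {K V ι : Type*} [Field K] [IsAlgClosed K]
    [AddCommGroup V] [Module K V] [FiniteDimensional K V] [Nontrivial V]
    (f : ι → Module.End K V) (hf : ∀ i j, Commute (f i) (f j)) :
    ∃ v : V, v ≠ 0 ∧ ∀ i, ∃ c : K, f i v = c • v := by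
  -- Take `W` minimal among nonzero jointly invariant subspaces. By commutativity an eigenspace of
  -- `f i` in `W` is again invariant, so it is all of `W`.
  obtain ⟨W, ⟨hW0, hW⟩, hmin⟩ := WellFounded.has_min
    (wellFounded_lt (α := Submodule K V))
    {W | W ≠ ⊥ ∧ ∀ i, ∀ w ∈ W, f i w ∈ W} ⟨⊤, top_ne_bot, fun _ _ _ => trivial⟩
  obtain ⟨v, hvW, hv0⟩ := W.ne_bot_iff.1 hW0
  refine ⟨v, hv0, fun i => ?_⟩
  have : Nontrivial W := Submodule.nontrivial_iff_ne_bot.2 hW0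
  obtain ⟨c, hc⟩ := Module.End.exists_eigenvalue ((f i).restrict (hW i))
  obtain ⟨w, hw⟩ := hc.exists_hasEigenvector
  have hwc : f i (w : V) = c • (w : V) := congrArg Subtype.val hw.apply_eq_smul
  let U : Submodule K V := W ⊓ LinearMap.ker (f i - c • 1)
  have memU : ∀ u, u ∈ U ↔ u ∈ W ∧ f i u = c • u := fun u => by simp [U, sub_eq_zero]
  have hU0 : U ≠ ⊥ := U.ne_bot_iff.2 ⟨w, (memU _).2 ⟨w.2, hwc⟩, by simpa using hw.2⟩
  have hU : ∀ j, ∀ u ∈ U, f j u ∈ U := fun j u hu => by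
    rw [memU] at hu ⊢
    refine ⟨hW j u hu.1, ?_⟩
    rw [← Module.End.mul_apply, (hf i j).eq, Module.End.mul_apply, hu.2, map_smul]
  have hUW : U = W := eq_of_le_of_not_lt inf_le_left (hmin U ⟨hU0, hU⟩)
  exact ⟨c, ((memU v).1 (hUW ▸ hvW)).2⟩

/-- An irreducible representation over an algebraically closed field has dimension at most the index
of any commutative subgroup of finite index. -/
theorem Representation.IsIrreducible.finrank_le_index {K G V : Type*} [Field K] [IsAlgClosed K]
    [Group G] [AddCommGroup V] [Module K V] [FiniteDimensional K V] (ρ : Representation K G V)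
    [hρ : ρ.IsIrreducible] (H : Subgroup G) [IsMulCommutative H] [H.FiniteIndex] :
    Module.finrank K V ≤ H.index := by
  have : Nontrivial V := by
    by_contra h
    rw [not_nontrivial_iff_subsingleton] at h
    exact bot_ne_top (α := Subrepresentation ρ)
      (Subrepresentation.toSubmodule_injective (Subsingleton.elim _ _))
  obtain ⟨v, hv0, hv⟩ := exists_common_eigenvector_of_commute (fun h : H => ρ (h : G))
    (fun a b => by
      have hab : (a : G) * b = b * a := congrArg Subtype.val (IsMulCommutative.is_comm.comm a b)
      rw [commute_iff_eq, ← map_mul, hab, map_mul])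
  -- `H` acts on `v` by scalars, so `ρ g v` depends, up to a scalar, only on the coset `gH`; one
  -- vector per coset spans an invariant subspace.
  let u : G ⧸ H → V := fun x => ρ x.out v
  let W := Submodule.span K (Set.range u)
  have hW : ∀ g : G, ρ g v ∈ W := fun g => by
    obtain ⟨h, hh⟩ := QuotientGroup.mk_out_eq_mul H g
    obtain ⟨c, hc⟩ := hv h⁻¹
    have : ρ g v = c • u (g : G ⧸ H) := by
      simp only [u, hh]
      rw [← map_smul, ← hc, ← Module.End.mul_apply, ← map_mul]
      simp
    rw [this]
    exact W.smul_mem _ (Submodule.subset_span ⟨_, rfl⟩)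
  let S : Subrepresentation ρ :=
    { toSubmodule := W
      apply_mem_toSubmodule := fun g w hw => by
        have : W ≤ W.comap (ρ g) := by
          refine Submodule.span_le.2 ?_
          rintro _ ⟨x, rfl⟩
          simpa [u] using hW (g * x.out)
        exact this hw }
  have hvW : v ∈ W := by simpa using hW 1
  have hS : S = ⊤ := (eq_bot_or_eq_top S).resolve_left fun h => hv0 <| by
    have : W = ⊥ := congrArg Subrepresentation.toSubmodule h
    simpa [this] using hvW
  have hWtop : W = ⊤ := congrArg Subrepresentation.toSubmodule hS
  have := Fintype.ofFinite (G ⧸ H)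
  calc Module.finrank K V = Module.finrank K W := by rw [hWtop, finrank_top]
    _ ≤ Fintype.card (G ⧸ H) := finrank_range_le_card u
    _ = H.index := by rw [Subgroup.index, Nat.card_eq_fintype_card]

theorem one_mem_characterDegrees (G : Type*) [Group G] : 1 ∈ characterDegrees G := by
  refine ⟨_, ⟨1, Representation.trivial ℂ G (Fin 1 → ℂ), ?_, rfl⟩, by
    simp [Representation.char_one]⟩
  have hsub : IsSimpleOrder (Submodule ℂ (Fin 1 → ℂ)) :=
    isSimpleModule_iff ℂ _ |>.1 (isSimpleModule_iff_finrank_eq_one.2 (by simp))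
  have : Nontrivial (Subrepresentation (Representation.trivial ℂ G (Fin 1 → ℂ))) :=
    ⟨⊥, ⊤, fun h => bot_ne_top (α := Submodule ℂ (Fin 1 → ℂ))
      (congrArg Subrepresentation.toSubmodule h)⟩
  exact ⟨fun S => (hsub.eq_bot_or_eq_top S.toSubmodule).imp
    (fun h => Subrepresentation.toSubmodule_injective h)
    (fun h => Subrepresentation.toSubmodule_injective h)⟩

theorem le_index_of_mem_characterDegrees {G : Type*} [Group G] (H : Subgroup G)
    [IsMulCommutative H] [H.FiniteIndex] {d : ℕ} (hd : d ∈ characterDegrees G) : d ≤ H.index := by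
  obtain ⟨_, ⟨n, ρ, hρ, rfl⟩, h⟩ := hd
  rw [Representation.char_one, Module.finrank_fin_fun, Nat.cast_inj] at h
  simpa [h] using Representation.IsIrreducible.finrank_le_index ρ H

theorem SimpleGraph.cycleGraph_exists_two_adj {n : ℕ} (hn : 3 ≤ n) (v : Fin n) :
    ∃ a b, a ≠ b ∧ (cycleGraph n).Adj v a ∧ (cycleGraph n).Adj v b := by
  obtain ⟨k, rfl⟩ := Nat.exists_eq_add_of_le' hn
  have h : 1 < ((cycleGraph (k + 3)).neighborFinset v).card := by
    rw [SimpleGraph.card_neighborFinset_eq_degree, SimpleGraph.cycleGraph_degree_three_le]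
    norm_num
  obtain ⟨a, ha, b, hb, hab⟩ := Finset.one_lt_card.1 h
  exact ⟨a, b, hab, by simpa using ha, by simpa using hb⟩

theorem IsCycleGraph.exists_two_adj {V : Type*} {Γ : SimpleGraph V} (h : IsCycleGraph Γ) (v : V) :
    ∃ a b, a ≠ b ∧ Γ.Adj v a ∧ Γ.Adj v b := by
  obtain ⟨n, hn, ⟨e⟩⟩ := h
  obtain ⟨a, b, hab, ha, hb⟩ := SimpleGraph.cycleGraph_exists_two_adj hn (e v)
  refine ⟨e.symm a, e.symm b, by simpa using hab, ?_, ?_⟩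
  · simpa [← e.map_adj_iff] using ha
  · simpa [← e.map_adj_iff] using hb

theorem IsCycleGraph.nonempty {V : Type*} {Γ : SimpleGraph V} (h : IsCycleGraph Γ) :
    Nonempty V := by
  obtain ⟨n, hn, ⟨e⟩⟩ := h
  exact ⟨e.symm ⟨0, by omega⟩⟩

section BipartiteDivisorGraph

variable {G : Type*} [Group G]

theorem exists_two_primes_dvd_of_isCycleGraph (h : IsCycleGraph (bipartiteDivisorGraph G)) {d : ℕ}
    (hd : d ∈ characterDegrees G) (h1 : d ≠ 1) :
    ∃ q r : ℕ, q ≠ r ∧ q.Prime ∧ r.Prime ∧ q ∈ degreePrimes G ∧ r ∈ degreePrimes G ∧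
      q ∣ d ∧ r ∣ d := by
  obtain ⟨q | _, r | _, hqr, hq, hr⟩ := h.exists_two_adj (.inr ⟨d, hd, h1⟩)
  · exact ⟨q, r, fun e => hqr (congrArg Sum.inl (Subtype.ext e)), q.2.1, r.2.1, q.2, r.2, hq, hr⟩
  · exact hr.elim
  · exact hq.elim
  · exact hq.elim

theorem exists_two_degrees_of_isCycleGraph (h : IsCycleGraph (bipartiteDivisorGraph G)) {q : ℕ}
    (hq : q ∈ degreePrimes G) :
    ∃ a b : ℕ, a ≠ b ∧ a ∈ characterDegrees G ∧ b ∈ characterDegrees G ∧ a ≠ 1 ∧ b ≠ 1 ∧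
      q ∣ a ∧ q ∣ b := by
  obtain ⟨_ | a, _ | b, hab, ha, hb⟩ := h.exists_two_adj (.inl ⟨q, hq⟩)
  · exact ha.elim
  · exact ha.elim
  · exact hb.elim
  · exact ⟨a, b, fun e => hab (congrArg Sum.inr (Subtype.ext e)), a.2.1, b.2.1, a.2.2, b.2.2, ha, hb⟩

theorem eq_of_two_primes_dvd_of_le_twelve {d q r : ℕ} (hd : d ≤ 12) (hd0 : d ≠ 0) (hqr : q ≠ r)
    (hq : q.Prime) (hr : r.Prime) (hqd : q ∣ d) (hrd : r ∣ d) : d = 6 ∨ d = 10 ∨ d = 12 := by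
  have h : ∀ d ≤ 12, d ≠ 0 → 1 < d.primeFactors.card → d = 6 ∨ d = 10 ∨ d = 12 := by
    intro d hd hd0
    interval_cases d <;> decide +kernel
  exact h d hd hd0 (Finset.one_lt_card.2
    ⟨q, Nat.mem_primeFactors.2 ⟨hq, hqd, hd0⟩, r, Nat.mem_primeFactors.2 ⟨hr, hrd, hd0⟩, hqr⟩)

/-- The zero space is not irreducible. Degree 0 must be excluded because every prime divides it. -/
theorem zero_notMem_characterDegrees : 0 ∉ characterDegrees G := by
  rintro ⟨_, ⟨n, ρ, hρ, rfl⟩, h⟩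
  rw [Representation.char_one, Module.finrank_fin_fun, Nat.cast_inj] at h
  subst h
  exact bot_ne_top (α := Subrepresentation ρ)
    (Subrepresentation.toSubmodule_injective (Subsingleton.elim _ _))

/-- If all degrees are at most `12` and the bipartite divisor graph is a cycle, then the degrees
are `1`, `6` and `12`. -/
theorem characterDegrees_eq_of_isCycleGraph (hle : ∀ d ∈ characterDegrees G, d ≤ 12)
    (h : IsCycleGraph (bipartiteDivisorGraph G)) : characterDegrees G = {1, 6, 12} := by
  have key : ∀ d ∈ characterDegrees G, d ≠ 1 → d = 6 ∨ d = 10 ∨ d = 12 := fun d hd h1 => by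
    obtain ⟨q, r, hqr, hq, hr, -, -, hqd, hrd⟩ := exists_two_primes_dvd_of_isCycleGraph h hd h1
    exact eq_of_two_primes_dvd_of_le_twelve (hle d hd)
      (fun e => zero_notMem_characterDegrees (e ▸ hd)) hqr hq hr hqd hrd
  -- The prime 5 would need a second neighbour, but it divides neither 6 nor 12.
  have h10 : 10 ∉ characterDegrees G := fun hd => by
    obtain ⟨a, b, hab, ha, hb, ha1, hb1, h5a, h5b⟩ :=
      exists_two_degrees_of_isCycleGraph h (q := 5) ⟨by norm_num, 10, hd, by norm_num⟩
    have := key a ha ha1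
    have := key b hb hb1
    omega
  have key' : ∀ d ∈ characterDegrees G, d ≠ 1 → d = 6 ∨ d = 12 := fun d hd h1 => by
    rcases key d hd h1 with e | e | e
    · exact .inl e
    · exact absurd (e ▸ hd) h10
    · exact .inr e
  have hex : ∃ d ∈ characterDegrees G, d ≠ 1 := by
    obtain ⟨q | m⟩ := h.nonempty
    · obtain ⟨a, -, -, ha, -, ha1, -⟩ := exists_two_degrees_of_isCycleGraph h q.2
      exact ⟨a, ha, ha1⟩
    · exact ⟨m, m.2.1, m.2.2⟩
  obtain ⟨d, hd, hd1⟩ := hex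
  -- The two neighbours of the prime 2 are distinct and lie in `{6, 12}`, so both occur.
  obtain ⟨a, b, hab, ha, hb, ha1, hb1, -⟩ := exists_two_degrees_of_isCycleGraph h (q := 2)
    ⟨Nat.prime_two, d, hd, by rcases key' d hd hd1 with rfl | rfl <;> norm_num⟩
  ext x
  simp only [Set.mem_insert_iff, Set.mem_singleton_iff]
  refine ⟨fun hx => or_iff_not_imp_left.2 (key' x hx), ?_⟩
  rcases key' a ha ha1 with rfl | rfl <;> rcases key' b hb hb1 with rfl | rfl
  · exact absurd rfl hab
  · rintro (rfl | rfl | rfl)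
    exacts [one_mem_characterDegrees G, ha, hb]
  · rintro (rfl | rfl | rfl)
    exacts [one_mem_characterDegrees G, hb, ha]
  · exact absurd rfl hab

theorem degreePrimes_eq_of_characterDegrees_eq (h : characterDegrees G = {1, 6, 12}) :
    degreePrimes G = {2, 3} := by
  ext q
  simp only [degreePrimes, h, Set.mem_ofPred_eq, Set.mem_insert_iff, Set.mem_singleton_iff]
  constructor
  · rintro ⟨hq, d, hd, hqd⟩
    have h12 : q ∣ 2 ^ 2 * 3 := hqd.trans (by rcases hd with rfl | rfl | rfl <;> norm_num)
    rcases hq.dvd_mul.1 h12 with h | h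
    · exact .inl ((Nat.prime_dvd_prime_iff_eq hq Nat.prime_two).1 (hq.dvd_of_dvd_pow h))
    · exact .inr ((Nat.prime_dvd_prime_iff_eq hq Nat.prime_three).1 h)
  · rintro (rfl | rfl)
    · exact ⟨Nat.prime_two, 6, by norm_num⟩
    · exact ⟨Nat.prime_three, 6, by norm_num⟩

theorem isCycleGraph_of_characterDegrees_eq (h : characterDegrees G = {1, 6, 12}) :
    IsCycleGraph (bipartiteDivisorGraph G) := by
  have hρ := degreePrimes_eq_of_characterDegrees_eq h
  have h2 : 2 ∈ degreePrimes G := by simp [hρ]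
  have h3 : 3 ∈ degreePrimes G := by simp [hρ]
  have h6 : 6 ∈ characterDegrees G \ {1} := by simp [h]
  have h12 : 12 ∈ characterDegrees G \ {1} := by simp [h]
  -- The vertices in cyclic order, primes alternating with degrees.
  let f : Fin 4 → ↥(degreePrimes G) ⊕ ↥(characterDegrees G \ {1}) :=
    ![.inl ⟨2, h2⟩, .inr ⟨6, h6⟩, .inl ⟨3, h3⟩, .inr ⟨12, h12⟩]
  have hf : Function.Bijective f := by
    constructor
    · intro i j hij
      fin_cases i <;> fin_cases j <;> simp [f] at hij ⊢
    · rintro (⟨q, hq⟩ | ⟨m, hm⟩)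
      · rcases (hρ ▸ hq : q ∈ ({2, 3} : Set ℕ)) with rfl | rfl
        exacts [⟨0, rfl⟩, ⟨2, rfl⟩]
      · rcases (h ▸ hm.1 : m ∈ ({1, 6, 12} : Set ℕ)) with rfl | rfl | rfl
        exacts [absurd rfl hm.2, ⟨1, rfl⟩, ⟨3, rfl⟩]
  refine ⟨4, by norm_num, ⟨SimpleGraph.Iso.symm ⟨Equiv.ofBijective f hf, ?_⟩⟩⟩
  intro i j
  fin_cases i <;> fin_cases j <;>
    simp [f, bipartiteDivisorGraph, SimpleGraph.cycleGraph_adj] <;> decide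

end BipartiteDivisorGraph

theorem proposition4p6 {G : Type*} [Group G] [Finite G] (hG : ∃ a b : G, a * b ≠ b * a)
    (p : ℕ) [Fact p.Prime] (hp7 : 7 ≤ p) (hp11 : p ≠ 11)
    (P : Sylow p G) (hP : Nat.card P = p ^ 2) (hindex : (P : Subgroup G).index = 12) :
    IsCycleGraph (bipartiteDivisorGraph G) ↔ characterDegrees G = {1, 6, 12} := by
  have : IsMulCommutative (P : Subgroup G) := IsPGroup.isMulCommutative_of_card_eq_prime_sq hP
  exact ⟨characterDegrees_eq_of_isCycleGraph fun d hd =>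
    hindex ▸ le_index_of_mem_characterDegrees (P : Subgroup G) hd,
    isCycleGraph_of_characterDegrees_eq⟩
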